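/- Let $\Sigma_g(\alpha_1,\dots,\alpha_r)$ ($g,r\ge 0$) denote the connected compact orientable surface of genus $g$ with boundary circles $\alpha_1,\dots,\alpha_r$. A cobordism from $n$ circles to $m$ circles is a finite disjoint union of such surfaces (closed components allowed) whose boundary circles are exactly the $n+m$ given circles, each occurring once; cobordisms are considered up to homeomorphism preserving the boundary circles. Let $\mathrm{Mor}(n,m)$ be the $\mathbb{Z}[\tfrac12]$-module of formal linear combinations of cobordisms from $n$ circles to $m$ circles, modulo the local relations * S: a cobordism with a sphere component is $0$; * T: a torus component may be removed and replaced by the factor $2$; * 4TU: if $D_1,\dots,D_4$ are disjoint disks in a cobordism $C$ (on arbitrary, possibly equal, components) and $C_{ij}$ is obtained from $C$ by removing $D_i,D_j$ and gluing in a tube with the same boundary, then $C_{12}+C_{34}=C_{13}+C_{24}$. This is the morphism group of $\mathcal{C}ob_{/l}$ over $\mathbb{Z}[\tfrac12]$. Let the variable $T$ of $\mathbb{Z}[\tfrac12,T]$ act on $\mathrm{Mor}(n,m)$ by $T\cdot\Sigma=\tfrac12\,(\Sigma\sqcup\Sigma_3)$, where $\Sigma_3$ is the closed connected surface of genus $3$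 (the genus-3 presentation). Then for all $n,m\ge 0$: 1. $T$ is the 2-handle operator: $T\cdot\Sigma$ equals the class of the surface obtained from $\Sigma$ by gluing two handles on any one of its components. 2. $\mathrm{Mor}(n,m)$ is a free $\mathbb{Z}[\tfrac12,T]$-module. A basis is given by the $2^{n+m}$ unions $\bigsqcup_{\alpha}\Sigma_{i_\alpha}(\alpha)$ over the $n+m$ circles $\alpha$, with $i_\alpha\in\{0,1\}$ (for $n=m=0$ this is the empty cobordism alone). In particular its rank is $2^{n+m}$. 3. In this basis, every cobordism is given by the surface reduction formula, applied to each component and extended multiplicatively to disjoint unions: $$\Sigma_g(\alpha_1,\dots,\alpha_r)=\frac{1}{2^{r-1}}\sum_{i_1,\dots,i_r\in\{0,1\}}\mathrm{odd}(g+z)\,T^{\lfloor (g+z)/2\rfloor}\,\Sigma_{i_1}(\alpha_1)\cdots\Sigma_{i_r}(\alpha_r),$$ where $z$ is the number of $0$'s among $i_1,\dots,i_r$ and $\mathrm{odd}(k)$ is $1$ for odd $k$ and $0$ for even $k$; for $r=0$ the right-hand side is $2\,\mathrm{odd}(g)\,T^{\lfloor g/2\rfloor}$ times the empty surface. -/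

import Mathlib

open Polynomial

/-- The ground ring `ℤ[1/2]`. -/
def ZHalf : Type := Localization.Away (2 : ℤ)

noncomputable instance : CommRing ZHalf :=
  inferInstanceAs (CommRing (Localization.Away (2 : ℤ)))

noncomputable instance : Algebra ℤ ZHalf :=
  inferInstanceAs (Algebra ℤ (Localization.Away (2 : ℤ)))

instance : IsLocalization.Away (2 : ℤ) ZHalf :=
  inferInstanceAs (IsLocalization.Away (2 : ℤ) (Localization.Away (2 : ℤ)))

/-- The element `1/2` of `ℤ[1/2]`. -/
noncomputable def ZHalf.half : ZHalf := IsLocalization.Away.invSelf (2 : ℤ)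

theorem ZHalf.two_mul_half : (2 : ZHalf) * ZHalf.half = 1 := by
  have h := IsLocalization.Away.mul_invSelf (S := ZHalf) (2 : ℤ)
  simpa [ZHalf.half] using h

/-- The connected compact orientable surface `Σ_g(α₁, …, α_r)` of genus `g` whose boundary circles
are `α₁, …, α_r`, all taken from the set of circles `S` (closed when there are none). -/
structure SurfaceComponent (S : Type) where
  boundary : Finset S
  genus : ℕ

instance (S : Type) [DecidableEq S] : DecidableEq (SurfaceComponent S) := fun c d =>
  decidable_of_iff (c.boundary = d.boundary ∧ c.genus = d.genus) (by
    cases c; cases d; simp)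

/-- A compact orientable surface whose set of boundary circles is `S`, up to homeomorphism that
preserves the boundary circles: a finite disjoint union `Σ_{g₁}(α, …) Σ_{g₂}(β, …) ⋯` of connected
surfaces (an unordered collection, in which closed components may be repeated) such that
each circle of `S` is a boundary circle of exactly one component, exactly once. -/
@[ext]
structure Surface (S : Type) [Fintype S] where
  components : Multiset (SurfaceComponent S)
  boundary_eq : (components.map fun c => c.boundary.val).sum = (Finset.univ : Finset S).val

namespace Surface

variable {S : Type} [Fintype S] [DecidableEq S]

/-- Here and below, an element of `C.components` used as a type is one particular component of `C`:
distinct components with equal data are distinct elements. This lemma removes one component. -/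
theorem exists_rest (C : Surface S) (i : C.components) :
    i.1 ::ₘ C.components.erase i.1 = C.components :=
  Multiset.cons_erase (Multiset.coe_mem)

theorem mem_erase_of_ne (C : Surface S) {i j : C.components} (h : i ≠ j) :
    j.1 ∈ C.components.erase i.1 := by
  by_cases hij : j.1 = i.1
  · rw [hij, ← Multiset.count_pos, Multiset.count_erase_self]
    rcases i with ⟨c, p⟩
    rcases j with ⟨d, q⟩
    change d = c at hij
    subst hij
    have hpq : (p : ℕ) ≠ q := fun hh => h (by rw [Fin.ext hh])
    have hp := p.2
    have hq := q.2
    change 0 < Multiset.count d C.components - 1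
    omega
  · exact (Multiset.mem_erase_of_ne hij).2 (Multiset.coe_mem)

theorem disjoint_boundary (C : Surface S) {i j : C.components} (h : i ≠ j) :
    Disjoint i.1.boundary j.1.boundary := by
  have hC := C.boundary_eq
  rw [← C.exists_rest i, ← Multiset.cons_erase (C.mem_erase_of_ne h)] at hC
  simp only [Multiset.map_cons, Multiset.sum_cons, ← add_assoc] at hC
  have hle : i.1.boundary.val + j.1.boundary.val ≤ (Finset.univ : Finset S).val := by
    rw [← hC]; exact Multiset.le_add_right _ _
  have hnd := Multiset.nodup_of_le hle Finset.univ.nodup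
  exact Finset.disjoint_val.1 (Multiset.nodup_add.1 hnd).2.2

/-- Glue `k` handles on the component `i` of `C`. -/
def addHandles (C : Surface S) (i : C.components) (k : ℕ) : Surface S where
  components := ⟨i.1.boundary, i.1.genus + k⟩ ::ₘ C.components.erase i.1
  boundary_eq := by
    have hC := C.boundary_eq
    rw [← C.exists_rest i, Multiset.map_cons, Multiset.sum_cons] at hC
    rw [Multiset.map_cons, Multiset.sum_cons]
    exact hC

open Classical in
/-- Remove two open disks of `C`, one on the component `i` and one on the component `j`, and glue in
a tube with the same boundary. If `i ≠ j` the two components get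
connected and the genera add up; if the disks are on the same component, it gets a handle. -/
noncomputable def tube (C : Surface S) (i j : C.components) : Surface S :=
  if h : i = j then C.addHandles i 1
  else
    { components :=
        ⟨i.1.boundary ∪ j.1.boundary, i.1.genus + j.1.genus⟩ ::ₘ
          (C.components.erase i.1).erase j.1
      boundary_eq := by
        have hC := C.boundary_eq
        rw [← C.exists_rest i, ← Multiset.cons_erase (C.mem_erase_of_ne h)] at hC
        have hd := C.disjoint_boundary h
        simp only [Multiset.map_cons, Multiset.sum_cons, ← add_assoc] at hC ⊢
        rw [← Finset.disjUnion_eq_union _ _ hd]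
        exact hC }


/-- The disjoint union of `C` with the closed connected surface of genus `g`. -/
def addClosed (C : Surface S) (g : ℕ) : Surface S where
  components := ⟨∅, g⟩ ::ₘ C.components
  boundary_eq := by simpa using C.boundary_eq

/-- The union of surfaces with exactly one boundary circle, the one with boundary circle `s`
having genus `ε s ∈ {0, 1}`. It is the empty surface if `S` is empty. -/
def generator (ε : S → Fin 2) : Surface S where
  components := Finset.univ.val.map fun s => ⟨{s}, (ε s : ℕ)⟩
  boundary_eq := by
    simp

/-- A component of `C`, seen as a component of the disjoint union of `C` with a closed surface. -/
def liftComponent (C : Surface S) (g : ℕ) (i : C.components) : (C.addClosed g).components :=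
  ⟨i.1, ⟨i.2, lt_of_lt_of_le i.2.2 (Multiset.count_le_count_cons _ _ _)⟩⟩

/-- The relations `S` (a sphere component gives `0`), `T` (a torus component may be dropped and
replaced by the factor `2`), and `4TU` (for four disks `D₁, …, D₄` on a surface `C`, lying on
arbitrary, possibly equal, components: `C₁₂ + C₃₄ = C₁₃ + C₂₄`). -/
inductive LocalRelation : (Surface S →₀ ZHalf) → Prop
  | sphere (C : Surface S) :
      LocalRelation (Finsupp.single (C.addClosed 0) 1)
  | torus (C : Surface S) :
      LocalRelation (Finsupp.single (C.addClosed 1) 1 - 2 • Finsupp.single C 1)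
  | fourTube (C : Surface S) (d₁ d₂ d₃ d₄ : C.components) :
      LocalRelation
        (Finsupp.single (C.tube d₁ d₂) 1 + Finsupp.single (C.tube d₃ d₄) 1
          - Finsupp.single (C.tube d₁ d₃) 1 - Finsupp.single (C.tube d₂ d₄) 1)

theorem addClosed_tube (C : Surface S) (g : ℕ) (i j : C.components) :
    (C.tube i j).addClosed g = (C.addClosed g).tube (C.liftComponent g i) (C.liftComponent g j) := by
  have hi : i.1 ∈ C.components := Multiset.coe_mem
  by_cases h : i = j
  · subst h
    rw [tube, dif_pos rfl, tube, dif_pos rfl]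
    apply Surface.ext
    change _ ::ₘ _ ::ₘ _ = _ ::ₘ (_ ::ₘ C.components).erase i.1
    rw [Multiset.erase_cons_tail_of_mem hi, Multiset.cons_swap]
    rfl
  · have h' : C.liftComponent g i ≠ C.liftComponent g j := by
      intro hh
      apply h
      rcases i with ⟨c, p⟩
      rcases j with ⟨d, q⟩
      simp only [liftComponent] at hh
      have h1 : c = d := congrArg Sigma.fst hh
      subst h1
      have h2 := congrArg Fin.val (eq_of_heq (Sigma.mk.inj hh).2)
      have h3 : (p : ℕ) = q := h2
      rw [Fin.ext h3]
    rw [tube, dif_neg h, tube, dif_neg h']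
    apply Surface.ext
    change _ ::ₘ _ ::ₘ _ = _ ::ₘ ((_ ::ₘ C.components).erase i.1).erase j.1
    rw [Multiset.erase_cons_tail_of_mem hi,
      Multiset.erase_cons_tail_of_mem (C.mem_erase_of_ne h), Multiset.cons_swap]
    rfl

theorem addClosed_comm {S : Type} [Fintype S] (C : Surface S) (g k : ℕ) :
    (C.addClosed g).addClosed k = (C.addClosed k).addClosed g := by
  simp only [addClosed, Surface.mk.injEq]
  exact Multiset.cons_swap _ _ _

/-- Disjoint union with the closed connected surface of genus `g` preserves the local relations. -/
theorem LocalRelation.addClosed {x : Surface S →₀ ZHalf} (hx : LocalRelation x) (g : ℕ) :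
    LocalRelation (Finsupp.lmapDomain ZHalf ZHalf (fun C => C.addClosed g) x) := by
  cases hx with
  | sphere C =>
    have := LocalRelation.sphere (C.addClosed g)
    simpa [addClosed_comm C g, Finsupp.mapDomain_single] using this
  | torus C =>
    have := LocalRelation.torus (C.addClosed g)
    simpa only [map_sub, map_nsmul, Finsupp.lmapDomain_apply, Finsupp.mapDomain_single,
      addClosed_comm C g] using this
  | fourTube C d₁ d₂ d₃ d₄ =>
    have := LocalRelation.fourTube (C.addClosed g) (C.liftComponent g d₁) (C.liftComponent g d₂)
      (C.liftComponent g d₃) (C.liftComponent g d₄)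
    simpa only [map_sub, map_add, Finsupp.lmapDomain_apply, Finsupp.mapDomain_single,
      addClosed_tube] using this

end Surface

/-- The `ℤ[1/2]`-module of formal linear combinations of surfaces with set of boundary circles `S`,
modulo the `S`, `T` and `4TU` relations. -/
def SurfaceModule (S : Type) [Fintype S] [DecidableEq S] : Type :=
  (Surface S →₀ ZHalf) ⧸ Submodule.span ZHalf {x : Surface S →₀ ZHalf | Surface.LocalRelation x}

namespace SurfaceModule

variable (S : Type) [Fintype S] [DecidableEq S]

noncomputable instance : AddCommGroup (SurfaceModule S) :=
  inferInstanceAs (AddCommGroup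
    ((Surface S →₀ ZHalf) ⧸ Submodule.span ZHalf {x : Surface S →₀ ZHalf | Surface.LocalRelation x}))

noncomputable instance : Module ZHalf (SurfaceModule S) :=
  inferInstanceAs (Module ZHalf
    ((Surface S →₀ ZHalf) ⧸ Submodule.span ZHalf {x : Surface S →₀ ZHalf | Surface.LocalRelation x}))

variable {S}

/-- The class of a surface modulo the local relations. -/
noncomputable def of (C : Surface S) : SurfaceModule S :=
  Submodule.Quotient.mk (Finsupp.single C 1)

variable (S)

/-- Disjoint union with the closed connected surface of genus `g`, extended linearly. -/
noncomputable def unionClosed (g : ℕ) : SurfaceModule S →ₗ[ZHalf] SurfaceModule S :=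
  Submodule.mapQ _ _ (Finsupp.lmapDomain ZHalf ZHalf fun C : Surface S => C.addClosed g) <| by
    rw [Submodule.span_le]
    exact fun x hx => Submodule.subset_span (Surface.LocalRelation.addClosed hx g)

/-- The genus-3 presentation of the 2-handle operator `T`: one half of the
disjoint union with the closed connected surface of genus 3. -/
noncomputable def twoHandle : Module.End ZHalf (SurfaceModule S) :=
  ZHalf.half • unionClosed S 3

/-- The module structure over `ℤ[1/2][T]`, in which the variable `T = X` acts as the 2-handle
operator in its genus-3 presentation. -/
noncomputable instance : Module ZHalf[X] (SurfaceModule S) :=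
  Module.compHom (SurfaceModule S) (aeval (twoHandle S)).toRingHom

variable {S}

theorem X_smul_of (C : Surface S) :
    (X : ZHalf[X]) • of C = ZHalf.half • of (C.addClosed 3) := by
  change (aeval (twoHandle S) (X : ZHalf[X])) (of C) = _
  rw [aeval_X]
  change ZHalf.half • unionClosed S 3 (of C) = _
  congr 1
  change Submodule.Quotient.mk (Finsupp.mapDomain _ (Finsupp.single C 1)) = _
  rw [Finsupp.mapDomain_single]
  rfl

theorem C_smul (a : ZHalf) (x : SurfaceModule S) : (Polynomial.C a : ZHalf[X]) • x = a • x := by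
  change (aeval (twoHandle S) (Polynomial.C a : ZHalf[X])) x = _
  rw [aeval_C]
  rfl

end SurfaceModule

/-- The morphism group of `Cob_{/l}` from `n` circles to `m` circles, over `ℤ[1/2]`: cobordisms
between them are the surfaces whose boundary circles are the `n` source and
the `m` target circles. -/
abbrev CobMor (n m : ℕ) : Type := SurfaceModule (Fin n ⊕ Fin m)

/-- The contribution of a component `Σ_g(α₁, …, α_r)` to the coefficient of the generator `ε` in the
surface reduction formula: `2^{1-r} odd(g+z) T^⌊(g+z)/2⌋`, where `z` is the number
of `i` with `ε αᵢ = 0`. -/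
noncomputable def reductionCoeff {S : Type} (c : SurfaceComponent S) (ε : S → Fin 2) : ZHalf[X] :=
  let a := c.genus + (c.boundary.filter fun s => ε s = 0).card
  if Odd a then C (2 * ZHalf.half ^ c.boundary.card) * X ^ (a / 2) else 0

/-! With the four disks placed as `i, i, j, j`, 4TU becomes neck cutting: twice a tube is the sum of
the two surfaces with a handle at one of its ends. Since 2 is invertible, this drives the whole
reduction. Applied to two tori it kills the closed surface of genus 2; tubing that surface to a
component then identifies half a closed genus-3 surface with two handles on that component
(`X_smul_ofComponents_cons`). Cutting off circles one at a time, trading pairs of handles for `X`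
and evaluating spheres and tori reduces every surface to generators (`ofComponents_mem_span`).

For independence, the reduction formula is taken as the definition of coordinates, multiplicative
over components. They respect 4TU because they satisfy neck cutting, which comes down to
`oddPow_add`, and they send generators to unit vectors (`coord_generator`). Hence the generators
form a basis and these are the coordinates in it. -/

instance : Nontrivial ZHalf :=
  (IsLocalization.injective ZHalf (M := Submonoid.powers (2 : ℤ))
    (powers_le_nonZeroDivisors_of_noZeroDivisors two_ne_zero)).nontrivial

theorem ZHalf.half_smul_two_nsmul {M : Type*} [AddCommGroup M] [Module ZHalf M] (x : M) :
    ZHalf.half • (2 • x) = x := by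
  rw [← Nat.cast_smul_eq_nsmul ZHalf, smul_smul, mul_comm, Nat.cast_ofNat, ZHalf.two_mul_half,
    one_smul]

namespace Surface

variable {S : Type} [Fintype S] [DecidableEq S]

/-- Two members of the multiset of components, exhibited as distinct components. -/
theorem exists_ne_of_components_eq (C : Surface S) {c d : SurfaceComponent S}
    {M : Multiset (SurfaceComponent S)} (hC : C.components = c ::ₘ d ::ₘ M) :
    ∃ i j : C.components, i ≠ j ∧ i.1 = c ∧ j.1 = d := by
  by_cases h : c = d
  · subst h
    have h2 : 1 < C.components.count c := by
      rw [hC, Multiset.count_cons_self, Multiset.count_cons_self]; omega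
    -- Equal data: the two components are the copies numbered 0 and 1.
    refine ⟨⟨c, ⟨0, by omega⟩⟩, ⟨c, ⟨1, h2⟩⟩, ?_, rfl, rfl⟩
    intro hh
    have := congrArg Fin.val (eq_of_heq (Sigma.mk.inj hh).2)
    simp at this
  · have hc : 0 < C.components.count c := Multiset.count_pos.2 (by simp [hC])
    have hd : 0 < C.components.count d := Multiset.count_pos.2 (by simp [hC])
    exact ⟨⟨c, ⟨0, hc⟩⟩, ⟨d, ⟨0, hd⟩⟩, fun hh => h (congrArg Sigma.fst hh), rfl, rfl⟩

theorem tube_self (C : Surface S) (i : C.components) : C.tube i i = C.addHandles i 1 := by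
  rw [tube, dif_pos rfl]

theorem tube_components (C : Surface S) {i j : C.components} (h : i ≠ j) :
    (C.tube i j).components = ⟨i.1.boundary ∪ j.1.boundary, i.1.genus + j.1.genus⟩ ::ₘ
      (C.components.erase i.1).erase j.1 := by
  rw [tube, dif_neg h]

theorem addHandles_components (C : Surface S) (i : C.components) (k : ℕ) :
    (C.addHandles i k).components =
      ⟨i.1.boundary, i.1.genus + k⟩ ::ₘ C.components.erase i.1 := rfl

end Surface

namespace SurfaceModule

variable {S : Type} [Fintype S] [DecidableEq S]

/-! ### The local relations and neck cutting -/

section Relations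

theorem mk_eq_zero {x : Surface S →₀ ZHalf} (hx : Surface.LocalRelation x) :
    (Submodule.Quotient.mk x : (Surface S →₀ ZHalf) ⧸
      Submodule.span ZHalf {x : Surface S →₀ ZHalf | Surface.LocalRelation x}) = 0 :=
  (Submodule.Quotient.mk_eq_zero _).2 (Submodule.subset_span hx)

theorem of_addClosed_zero (C : Surface S) : of (C.addClosed 0) = 0 :=
  mk_eq_zero (Surface.LocalRelation.sphere C)

theorem of_addClosed_one (C : Surface S) : of (C.addClosed 1) = 2 • of C :=
  sub_eq_zero.1 (mk_eq_zero (Surface.LocalRelation.torus C))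

theorem of_fourTube (C : Surface S) (d₁ d₂ d₃ d₄ : C.components) :
    of (C.tube d₁ d₂) + of (C.tube d₃ d₄) = of (C.tube d₁ d₃) + of (C.tube d₂ d₄) := by
  have h : of (C.tube d₁ d₂) + of (C.tube d₃ d₄) - of (C.tube d₁ d₃) - of (C.tube d₂ d₄) = 0 :=
    mk_eq_zero (Surface.LocalRelation.fourTube C d₁ d₂ d₃ d₄)
  rw [sub_sub] at h
  exact sub_eq_zero.1 h

/-- Neck cutting: twice a tube is the sum of the two surfaces with a handle on one of its ends. -/
theorem two_nsmul_of_tube (C : Surface S) (i j : C.components) :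
    2 • of (C.tube i j) = of (C.addHandles i 1) + of (C.addHandles j 1) := by
  rw [two_nsmul, ← C.tube_self i, ← C.tube_self j, of_fourTube C i i j j]

end Relations

/-! ### Linear maps out of the quotient -/

section Lift

theorem linearMap_ext {M : Type*} [AddCommGroup M] [Module ZHalf M]
    {f g : SurfaceModule S →ₗ[ZHalf] M} (h : ∀ C, f (of C) = g (of C)) : f = g := by
  refine Submodule.linearMap_qext _ ?_
  refine Finsupp.lhom_ext' fun C => LinearMap.ext_ring ?_
  exact h C

/-- A function on surfaces that respects the local relations, extended linearly. -/
noncomputable def lift {M : Type*} [AddCommGroup M] [Module ZHalf M] (f : Surface S → M)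
    (hS : ∀ C : Surface S, f (C.addClosed 0) = 0)
    (hT : ∀ C : Surface S, f (C.addClosed 1) = 2 • f C)
    (h4 : ∀ (C : Surface S) (d₁ d₂ d₃ d₄ : C.components),
      f (C.tube d₁ d₂) + f (C.tube d₃ d₄) = f (C.tube d₁ d₃) + f (C.tube d₂ d₄)) :
    SurfaceModule S →ₗ[ZHalf] M :=
  Submodule.liftQ _ (Finsupp.linearCombination ZHalf f) <| by
    rw [Submodule.span_le]
    rintro x (C | C | ⟨C, d₁, d₂, d₃, d₄⟩)
    · simp [hS]
    · rw [SetLike.mem_coe, LinearMap.mem_ker, map_sub, map_nsmul,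
        Finsupp.linearCombination_single, Finsupp.linearCombination_single, one_smul, one_smul, hT,
        sub_self]
    · simp [h4]

theorem lift_of {M : Type*} [AddCommGroup M] [Module ZHalf M] (f : Surface S → M) (hS hT h4)
    (C : Surface S) : lift f hS hT h4 (of C) = f C := by
  change Finsupp.linearCombination ZHalf f (Finsupp.single C 1) = f C
  simp

end Lift

/-! ### Handles and closed components -/

section OfComponents

/-- The class of the surface with the given components, or `0` if there is no such surface. -/
noncomputable def ofComponents (M : Multiset (SurfaceComponent S)) : SurfaceModule S :=
  if h : (M.map fun c => c.boundary.val).sum = (Finset.univ : Finset S).val then of ⟨M, h⟩ else 0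

theorem of_eq_ofComponents (C : Surface S) : of C = ofComponents C.components := by
  rw [ofComponents, dif_pos C.boundary_eq]

theorem ofComponents_eq_zero {M : Multiset (SurfaceComponent S)}
    (h : (M.map fun c => c.boundary.val).sum ≠ (Finset.univ : Finset S).val) :
    ofComponents M = 0 := dif_neg h

theorem ofComponents_sphere (M : Multiset (SurfaceComponent S)) :
    ofComponents (⟨∅, 0⟩ ::ₘ M) = 0 := by
  by_cases h : (M.map fun c => c.boundary.val).sum = (Finset.univ : Finset S).val
  · have := of_addClosed_zero ⟨M, h⟩
    rwa [of_eq_ofComponents] at this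
  · exact ofComponents_eq_zero (by simpa using h)

theorem ofComponents_torus (M : Multiset (SurfaceComponent S)) :
    ofComponents (⟨∅, 1⟩ ::ₘ M) = 2 • ofComponents M := by
  by_cases h : (M.map fun c => c.boundary.val).sum = (Finset.univ : Finset S).val
  · have := of_addClosed_one ⟨M, h⟩
    rwa [of_eq_ofComponents, of_eq_ofComponents] at this
  · rw [ofComponents_eq_zero h, ofComponents_eq_zero (by simpa using h), smul_zero]

theorem two_nsmul_ofComponents_union {A B : Finset S} (hAB : Disjoint A B) (g k : ℕ)
    (M : Multiset (SurfaceComponent S)) :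
    2 • ofComponents (⟨A ∪ B, g + k⟩ ::ₘ M) =
      ofComponents (⟨A, g + 1⟩ ::ₘ ⟨B, k⟩ ::ₘ M) + ofComponents (⟨A, g⟩ ::ₘ ⟨B, k + 1⟩ ::ₘ M) := by
  by_cases h : ((⟨A, g⟩ ::ₘ ⟨B, k⟩ ::ₘ M : Multiset (SurfaceComponent S)).map
      fun c => c.boundary.val).sum = (Finset.univ : Finset S).val
  · obtain ⟨i, j, hij, hi, hj⟩ := Surface.exists_ne_of_components_eq
      (⟨⟨A, g⟩ ::ₘ ⟨B, k⟩ ::ₘ M, h⟩ : Surface S) rfl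
    have := two_nsmul_of_tube _ i j
    simp only [of_eq_ofComponents, Surface.tube_components _ hij, Surface.addHandles_components,
      hi, hj, Multiset.erase_cons_head] at this
    rw [this, Multiset.cons_swap ⟨A, g⟩ ⟨B, k⟩ M, Multiset.erase_cons_head,
      Multiset.cons_swap ⟨A, g⟩ ⟨B, k + 1⟩ M]
  -- All three multisets have the same total boundary, as `A` and `B` are disjoint, so every term
  -- takes the default value 0.
  · rw [ofComponents_eq_zero (M := _ ::ₘ M), ofComponents_eq_zero, ofComponents_eq_zero]
    · simp
    · simpa using h
    · simpa using h
    · rw [← Finset.disjUnion_eq_union _ _ hAB]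
      simp only [Multiset.map_cons, Multiset.sum_cons, ← add_assoc] at h ⊢
      exact h

/-- Neck cutting between two tori puts a genus-2 surface beside a torus on the right, twice. The
torus counts 2, so halving gives `Σ₂ = Σ₂ + Σ₂`. -/
theorem ofComponents_genus_two (M : Multiset (SurfaceComponent S)) :
    ofComponents (⟨∅, 2⟩ ::ₘ M) = 0 := by
  have h := two_nsmul_ofComponents_union (Finset.disjoint_empty_left (∅ : Finset S)) 1 1 M
  rw [Multiset.cons_swap ⟨∅, 1 + 1⟩ ⟨∅, 1⟩ M, ofComponents_torus, Finset.empty_union,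
    ← smul_add, ← two_nsmul] at h
  have h' := congrArg (ZHalf.half • ·) h
  simp only [ZHalf.half_smul_two_nsmul] at h'
  rw [two_nsmul] at h'
  exact left_eq_add.1 h'

theorem X_smul_ofComponents (M : Multiset (SurfaceComponent S)) :
    (X : ZHalf[X]) • ofComponents M = ZHalf.half • ofComponents (⟨∅, 3⟩ ::ₘ M) := by
  by_cases h : (M.map fun c => c.boundary.val).sum = (Finset.univ : Finset S).val
  · have := X_smul_of ⟨M, h⟩
    rwa [of_eq_ofComponents, of_eq_ofComponents] at this
  · rw [ofComponents_eq_zero h, ofComponents_eq_zero (by simpa using h), smul_zero, smul_zero]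

/-- The operator `X` glues two handles on an arbitrary component. -/
theorem X_smul_ofComponents_cons (A : Finset S) (g : ℕ) (M : Multiset (SurfaceComponent S)) :
    (X : ZHalf[X]) • ofComponents (⟨A, g⟩ ::ₘ M) = ofComponents (⟨A, g + 2⟩ ::ₘ M) := by
  -- Tube the component to a closed genus-2 surface: the handle lands on the component, leaving the
  -- vanishing factor `Σ₂`, or on `Σ₂`, making it `Σ₃`.
  have h := two_nsmul_ofComponents_union (Finset.disjoint_empty_right A) g 2 M
  rw [Multiset.cons_swap ⟨A, g + 1⟩ ⟨∅, 2⟩ M, ofComponents_genus_two, zero_add, Finset.union_empty,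
    Multiset.cons_swap ⟨A, g⟩ ⟨∅, 2 + 1⟩ M] at h
  rw [X_smul_ofComponents, ← h, ZHalf.half_smul_two_nsmul]

theorem X_smul_of_eq_addHandles (C : Surface S) (i : C.components) :
    (X : ZHalf[X]) • of C = of (C.addHandles i 2) := by
  rw [of_eq_ofComponents, of_eq_ofComponents, Surface.addHandles_components,
    ← X_smul_ofComponents_cons]
  exact congrArg _ (congrArg _ (C.exists_rest i).symm)

end OfComponents

/-! ### The generators span -/

section Spanning

theorem map_singleton_sum_val {S : Type} {M : Multiset (Finset S)} (h : ∀ B ∈ M, B.card = 1) :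
    (M.map Finset.val).sum.map (fun s => ({s} : Finset S)) = M := by
  induction M using Multiset.induction_on with
  | empty => simp
  | cons B M ih =>
    obtain ⟨s, rfl⟩ := Finset.card_eq_one.1 (h B (Multiset.mem_cons_self _ _))
    rw [Multiset.map_cons, Multiset.sum_cons, Multiset.map_add,
      ih fun B hB => h B (Multiset.mem_cons_of_mem hB)]
    simp

/-- The boundaries are the singletons of `S`, each once, so a component is determined by its circle
and `ε` reads off its genus. -/
theorem exists_eq_generator {S : Type} [Fintype S] (C : Surface S)
    (h : ∀ c ∈ C.components, c.boundary.card = 1 ∧ c.genus < 2) :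
    ∃ ε, C = Surface.generator ε := by
  have hmap : C.components.map SurfaceComponent.boundary =
      Finset.univ.val.map fun s => ({s} : Finset S) := by
    rw [← C.boundary_eq, ← map_singleton_sum_val (M := C.components.map SurfaceComponent.boundary),
      Multiset.map_map]
    · rfl
    · intro B hB
      obtain ⟨c, hc, rfl⟩ := Multiset.mem_map.1 hB
      exact (h c hc).1
  have hnd : (C.components.map SurfaceComponent.boundary).Nodup := by
    rw [hmap]
    exact Finset.univ.nodup.map Finset.singleton_injective
  have hinj := Multiset.inj_on_of_nodup_map hnd
  have hex : ∀ s : S, ∃ k : Fin 2, (⟨{s}, k⟩ : SurfaceComponent S) ∈ C.components := by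
    intro s
    have hs : ({s} : Finset S) ∈ C.components.map SurfaceComponent.boundary := by
      rw [hmap]; exact Multiset.mem_map.2 ⟨s, Finset.mem_univ _, rfl⟩
    obtain ⟨⟨B, g⟩, hc, rfl⟩ := Multiset.mem_map.1 hs
    exact ⟨⟨g, (h _ hc).2⟩, hc⟩
  choose ε hε using hex
  refine ⟨ε, Surface.ext ((Multiset.Nodup.ext hnd.of_map ?_).2 fun c => ?_)⟩
  · refine Finset.univ.nodup.map fun s t hst => ?_
    exact Finset.singleton_injective (congrArg SurfaceComponent.boundary hst)
  · constructor
    · intro hc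
      obtain ⟨s, hs⟩ := Finset.card_eq_one.1 (h c hc).1
      exact Multiset.mem_map.2 ⟨s, Finset.mem_univ _, hinj _ (hε s) _ hc hs.symm⟩
    · intro hc
      obtain ⟨s, -, rfl⟩ := Multiset.mem_map.1 hc
      exact hε s

/-- A complexity of components that every step of the reduction to generators lowers. -/
def weight (c : SurfaceComponent S) : ℕ := 1 + c.genus + 3 * (c.boundary.card - 1)

theorem half_smul_mem {N : Submodule ZHalf[X] (SurfaceModule S)} {x : SurfaceModule S}
    (h : 2 • x ∈ N) : x ∈ N := by
  rw [← ZHalf.half_smul_two_nsmul x, ← C_smul]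
  exact N.smul_mem _ h

theorem ofComponents_mem_span (n : ℕ) (M : Multiset (SurfaceComponent S))
    (hM : (M.map weight).sum = n) : ofComponents M ∈ Submodule.span ZHalf[X]
      (Set.range fun ε : S → Fin 2 => of (Surface.generator ε)) := by
  induction n using Nat.strong_induction_on generalizing M with
  | _ n ih =>
  have key (M') (h : (M'.map weight).sum < n) := ih _ h M' rfl
  by_cases hg : ∀ c ∈ M, c.boundary.card = 1 ∧ c.genus < 2
  · by_cases hb : (M.map fun c => c.boundary.val).sum = (Finset.univ : Finset S).val
    · obtain ⟨ε, hε⟩ := exists_eq_generator ⟨M, hb⟩ hg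
      rw [ofComponents, dif_pos hb, hε]
      exact Submodule.subset_span ⟨ε, rfl⟩
    · rw [ofComponents_eq_zero hb]
      exact Submodule.zero_mem _
  · push Not at hg
    obtain ⟨⟨B, g⟩, hc, hcg⟩ := hg
    obtain ⟨N, rfl⟩ := Multiset.exists_cons_of_mem hc
    rw [Multiset.map_cons, Multiset.sum_cons] at hM
    by_cases h2 : 2 ≤ g
    · obtain ⟨k, rfl⟩ := Nat.exists_eq_add_of_le' h2
      rw [← X_smul_ofComponents_cons]
      refine Submodule.smul_mem _ _ (key _ ?_)
      simp only [Multiset.map_cons, Multiset.sum_cons, weight] at hM ⊢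
      omega
    · have hB : B.card ≠ 1 := fun hB => h2 (hcg hB)
      obtain rfl | ⟨s, hs⟩ := B.eq_empty_or_nonempty
      · obtain rfl | rfl : g = 0 ∨ g = 1 := by omega
        · rw [ofComponents_sphere]
          exact Submodule.zero_mem _
        · rw [ofComponents_torus]
          refine Submodule.smul_of_tower_mem _ _ (key _ ?_)
          simp only [weight] at hM
          omega
      · have hcard := Finset.card_erase_of_mem hs
        have hpos := Finset.card_pos.2 ⟨s, hs⟩
        -- The circle `s` is cut off onto a component of its own, with genus split as `g + 0`.
        have h := two_nsmul_ofComponents_union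
          (Finset.disjoint_singleton_right.2 (Finset.notMem_erase s B)) g 0 N
        rw [Finset.union_comm, ← Finset.insert_eq, Finset.insert_erase hs, add_zero] at h
        refine half_smul_mem ?_
        rw [h]
        -- Losing a circle saves 3, while the new component and the extra handle cost 1 each.
        refine Submodule.add_mem _ (key _ ?_) (key _ ?_) <;>
        · simp only [Multiset.map_cons, Multiset.sum_cons, weight, Finset.card_singleton,
            hcard] at hM ⊢
          omega

theorem span_generator : Submodule.span ZHalf[X]
    (Set.range fun ε : S → Fin 2 => of (Surface.generator ε)) = ⊤ := by
  let N := Submodule.span ZHalf[X] (Set.range fun ε : S → Fin 2 => of (Surface.generator ε))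
  have hof (C : Surface S) : of C ∈ N := by
    rw [of_eq_ofComponents]
    exact ofComponents_mem_span _ _ rfl
  refine Submodule.eq_top_iff'.2 fun x => ?_
  obtain ⟨y, rfl⟩ := Submodule.Quotient.mk_surjective _ x
  induction y using Finsupp.induction_linear with
  | zero => exact N.zero_mem
  | add y z hy hz => exact N.add_mem hy hz
  | single C a =>
    have : (Submodule.Quotient.mk (Finsupp.single C a) : SurfaceModule S) = a • of C := by
      change _ = Submodule.Quotient.mk (a • Finsupp.single C 1)
      simp
    erw [this]
    rw [← C_smul]
    exact N.smul_mem _ (hof C)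

end Spanning

/-! ### Coordinates from the reduction formula and independence -/

section Coordinates

/-- The term `odd(a) T^⌊a/2⌋` of the surface reduction formula. -/
noncomputable def oddPow (a : ℕ) : ZHalf[X] := if Odd a then X ^ (a / 2) else 0

/-- If `h ^ 2 = X`, then `h ^ a = oddPow (a + 1) + oddPow a * h`; this is the coefficient of `h` in
`h ^ a * h ^ b`. -/
theorem oddPow_add (a b : ℕ) :
    oddPow (a + b) = oddPow (a + 1) * oddPow b + oddPow a * oddPow (b + 1) := by
  rcases Nat.even_or_odd' a with ⟨k, rfl | rfl⟩ <;> rcases Nat.even_or_odd' b with ⟨l, rfl | rfl⟩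
  all_goals
    simp only [oddPow, Nat.odd_iff]
    split_ifs <;> first | omega | skip
    try simp
  all_goals rw [← pow_add]; congr 1; omega

theorem reductionCoeff_eq {S : Type} (c : SurfaceComponent S) (ε : S → Fin 2) :
    reductionCoeff c ε = Polynomial.C (2 * ZHalf.half ^ c.boundary.card) *
      oddPow (c.genus + (c.boundary.filter fun s => ε s = 0).card) := by
  simp only [reductionCoeff, oddPow, mul_ite, mul_zero]

theorem two_mul_reductionCoeff_union {S : Type} [DecidableEq S] {A B : Finset S}
    (hAB : Disjoint A B) (g k : ℕ) (ε : S → Fin 2) :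
    2 * reductionCoeff ⟨A ∪ B, g + k⟩ ε =
      reductionCoeff ⟨A, g + 1⟩ ε * reductionCoeff ⟨B, k⟩ ε +
        reductionCoeff ⟨A, g⟩ ε * reductionCoeff ⟨B, k + 1⟩ ε := by
  simp only [reductionCoeff_eq, Finset.card_union_of_disjoint hAB, Finset.filter_union,
    Finset.card_union_of_disjoint (Finset.disjoint_filter_filter hAB)]
  rw [add_add_add_comm g k, oddPow_add, add_right_comm g, add_right_comm k]
  simp only [map_mul, map_pow, pow_add, map_ofNat]
  ring

/-- The coefficient of a generator in the surface reduction formula. -/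
noncomputable def coord (C : Surface S) (ε : S → Fin 2) : ZHalf[X] :=
  (C.components.map fun c => reductionCoeff c ε).prod

theorem coord_addClosed {S : Type} [Fintype S] (C : Surface S) (g : ℕ) (ε : S → Fin 2) :
    coord (C.addClosed g) ε = 2 * oddPow g * coord C ε := by
  rw [coord, Surface.addClosed, Multiset.map_cons, Multiset.prod_cons, reductionCoeff_eq]
  simp only [Finset.card_empty, pow_zero, mul_one, map_ofNat, Finset.filter_empty, add_zero, coord]

theorem two_mul_coord_tube (C : Surface S) (i j : C.components) (ε : S → Fin 2) :
    2 * coord (C.tube i j) ε = coord (C.addHandles i 1) ε + coord (C.addHandles j 1) ε := by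
  by_cases h : i = j
  · subst h
    rw [Surface.tube_self, two_mul]
  · obtain ⟨N, hN⟩ := Multiset.exists_cons_of_mem (C.mem_erase_of_ne h)
    have hC := C.exists_rest i
    rw [hN] at hC
    have hj : C.components.erase j.1 = i.1 ::ₘ N := by
      have := congrArg (Multiset.erase · j.1) hC
      simpa only [Multiset.cons_swap i.1 j.1, Multiset.erase_cons_head] using this.symm
    simp only [coord, Surface.tube_components C h, Surface.addHandles_components, hN, hj,
      Multiset.erase_cons_head, Multiset.map_cons, Multiset.prod_cons]
    rw [← mul_assoc, two_mul_reductionCoeff_union (C.disjoint_boundary h)]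
    ring

/-- A tube becomes a sum of one term per end, so each side of 4TU is half the sum of the same four
terms. -/
theorem coord_tube (C : Surface S) (i j : C.components) :
    coord (C.tube i j) = ZHalf.half • (coord (C.addHandles i 1) + coord (C.addHandles j 1)) := by
  have : coord (C.addHandles i 1) + coord (C.addHandles j 1) = 2 • coord (C.tube i j) := by
    funext ε
    rw [Pi.add_apply, ← two_mul_coord_tube, Pi.smul_apply, nsmul_eq_mul, Nat.cast_ofNat]
  rw [this, ZHalf.half_smul_two_nsmul]

theorem coord_generator {S : Type} [Fintype S] (δ : S → Fin 2) :
    coord (Surface.generator δ) = Pi.single δ 1 := by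
  -- Genus plus number of zeros is 1 when `ε s = δ s`, and 0 or 2 otherwise.
  have hc (s : S) (ε : S → Fin 2) :
      reductionCoeff ⟨{s}, (δ s : ℕ)⟩ ε = if ε s = δ s then 1 else 0 := by
    rw [reductionCoeff_eq, Finset.card_singleton, pow_one, ZHalf.two_mul_half, map_one, one_mul,
      Finset.filter_singleton]
    generalize ε s = a
    generalize δ s = b
    fin_cases a <;> fin_cases b <;> simp [oddPow, Nat.odd_iff]
  funext ε
  have : coord (Surface.generator δ) ε = ∏ s, if ε s = δ s then (1 : ZHalf[X]) else 0 := by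
    simp only [coord, Surface.generator, Multiset.map_map, Function.comp_def, hc]
    rfl
  rw [this, Finset.prod_ite_zero, Pi.single_apply]
  simp [funext_iff]

/-- The coordinates given by the surface reduction formula, over the ground ring. -/
noncomputable def coordGround : SurfaceModule S →ₗ[ZHalf] ((S → Fin 2) → ZHalf[X]) :=
  lift coord
    (fun C => by funext ε; simp [coord_addClosed, oddPow])
    (fun C => by funext ε; simp [coord_addClosed, oddPow])
    (fun C d₁ d₂ d₃ d₄ => by
      simp only [coord_tube, ← smul_add]
      congr 1
      abel)

theorem coordGround_of (C : Surface S) : coordGround (of C) = coord C := lift_of ..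

/-- A closed genus-3 component contributes the factor `2 * X`, and the 2 cancels the half in the
action of `X`. -/
theorem coordGround_X_smul (x : SurfaceModule S) :
    coordGround ((X : ZHalf[X]) • x) = (X : ZHalf[X]) • coordGround x := by
  have hX (x : SurfaceModule S) : (X : ZHalf[X]) • x = twoHandle S x := by
    change aeval (twoHandle S) (X : ZHalf[X]) x = _
    rw [aeval_X]
  have : coordGround ∘ₗ twoHandle S =
      (LinearMap.lsmul ZHalf[X] ((S → Fin 2) → ZHalf[X]) X).restrictScalars ZHalf ∘ₗ
        coordGround := by
    refine linearMap_ext fun C => ?_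
    change coordGround (twoHandle S (of C)) = (X : ZHalf[X]) • coordGround (of C)
    rw [← hX, X_smul_of, map_smul, coordGround_of, coordGround_of]
    have : coord (C.addClosed 3) = 2 • (X : ZHalf[X]) • coord C := by
      funext ε
      simp [coord_addClosed, oddPow, Nat.odd_iff, mul_assoc]
    rw [this, ZHalf.half_smul_two_nsmul]
  rw [hX]
  exact LinearMap.congr_fun this x

/-- The coordinates given by the surface reduction formula. -/
noncomputable def coordLinear : SurfaceModule S →ₗ[ZHalf[X]] ((S → Fin 2) → ZHalf[X]) where
  toFun := coordGround
  map_add' := map_add _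
  map_smul' p x := by
    rw [RingHom.id_apply]
    have hC (a : ZHalf) (x : SurfaceModule S) : coordGround (Polynomial.C a • x) =
        (Polynomial.C a : ZHalf[X]) • coordGround x := by
      rw [C_smul, map_smul]
      funext ε
      simp [Polynomial.smul_eq_C_mul]
    induction p using Polynomial.induction_on generalizing x with
    | C a => exact hC a x
    | add p q hp hq => rw [add_smul, map_add, hp, hq, add_smul]
    | monomial n a h => rw [pow_succ, ← mul_assoc, mul_smul, h, coordGround_X_smul, ← mul_smul]

theorem coordLinear_of (C : Surface S) : coordLinear (of C) = coord C := coordGround_of C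

theorem linearIndependent_generator :
    LinearIndependent ZHalf[X] fun ε : S → Fin 2 => of (Surface.generator ε) := by
  refine LinearIndependent.of_comp coordLinear ?_
  have : ⇑coordLinear ∘ (fun ε : S → Fin 2 => of (Surface.generator ε)) =
      Pi.basisFun ZHalf[X] (S → Fin 2) := by
    funext ε
    rw [Function.comp_apply, coordLinear_of, coord_generator, Pi.basisFun_apply]
  rw [this]
  exact (Pi.basisFun ZHalf[X] (S → Fin 2)).linearIndependent

variable (S) in
/-- The generators as a basis. -/
noncomputable def generatorBasis : Module.Basis (S → Fin 2) ZHalf[X] (SurfaceModule S) :=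
  Module.Basis.mk linearIndependent_generator span_generator.ge

theorem generatorBasis_apply (ε : S → Fin 2) :
    generatorBasis S ε = of (Surface.generator ε) := by
  rw [generatorBasis, Module.Basis.mk_apply]

/-- Both maps send each generator to its unit vector. -/
theorem generatorBasis_equivFun : (generatorBasis S).equivFun.toLinearMap = coordLinear := by
  refine (generatorBasis S).ext fun ε => ?_
  rw [generatorBasis_apply, coordLinear_of, coord_generator, ← generatorBasis_apply]
  funext δ
  simp [Pi.single_apply, eq_comm]

end Coordinates

end SurfaceModule

theorem mainTheorem2 (n m : ℕ) :
    -- the variable `T` acts as the 2-handle operator, wherever the 2-handle is glued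
    (∀ (C : Surface (Fin n ⊕ Fin m)) (i : C.components),
      (X : ZHalf[X]) • (SurfaceModule.of C : CobMor n m) = SurfaceModule.of (C.addHandles i 2)) ∧
    -- the generators are a basis, and coordinates are given by the surface reduction formula
    (∃ b : Module.Basis (Fin n ⊕ Fin m → Fin 2) ZHalf[X] (CobMor n m),
      (∀ ε, b ε = SurfaceModule.of (Surface.generator ε)) ∧
      ∀ (C : Surface (Fin n ⊕ Fin m)) (ε : Fin n ⊕ Fin m → Fin 2),
        b.repr (SurfaceModule.of C) ε = (C.components.map fun c => reductionCoeff c ε).prod) ∧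
    -- the rank
    Module.Free ZHalf[X] (CobMor n m) ∧
    Module.finrank ZHalf[X] (CobMor n m) = 2 ^ (n + m) := by
  refine ⟨SurfaceModule.X_smul_of_eq_addHandles,
    ⟨SurfaceModule.generatorBasis _, SurfaceModule.generatorBasis_apply, fun C ε => ?_⟩,
    Module.Free.of_basis (SurfaceModule.generatorBasis _), ?_⟩
  · have h := LinearMap.congr_fun SurfaceModule.generatorBasis_equivFun (SurfaceModule.of C)
    rw [SurfaceModule.coordLinear_of] at h
    exact congrFun h ε
  -- The rank is well defined because `ZHalf` is nontrivial.
  · rw [Module.finrank_eq_card_basis (SurfaceModule.generatorBasis _)]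
    simp
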